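/- \textbf{Definitions.} A \emph{distributive contact lattice} is a bounded distributive lattice $(D,\le,0,1,+,\cdot)$ with a binary relation $C$ (contact) such that: (C1) $aCb$ implies $a,b\neq 0$; (C2) $aCb$, $a\le a'$, $b\le b'$ imply $a'Cb'$; (C3) $aC(b+c)$ implies $aCb$ or $aCc$; (C4) $aCb$ implies $bCa$; (C5) $a\cdot b\ne 0$ implies $aCb$. A \emph{contact algebra} is a Boolean algebra with such a relation. An overline denotes the negation of a relation. An \emph{EDC-lattice} $(D,C,\widehat C,\ll)$ is a distributive contact lattice with two further binary relations $\widehat C$ (dual contact) and $\ll$ such that: ($\widehat C$1) $a\widehat Cb$ implies $a,b\ne 1$; ($\widehat C$2) $a\widehat Cb$, $a'\le a$, $b'\le b$ imply $a'\widehat Cb'$; ($\widehat C$3) $a\widehat C(b\cdot c)$ implies $a\widehat Cb$ or $a\widehat Cc$; ($\widehat C$4) $a\widehat Cb$ implies $b\widehat Ca$; ($\widehat C$5) $a+b\neq 1$ implies $a\widehat Cb$; ($\ll$1) $0\ll 0$; ($\ll$2) $1\ll 1$; ($\ll$3) $a\ll b$ implies $a\le b$; ($\ll$4) $a'\le a\ll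 b\le b'$ implies $a'\ll b'$; ($\ll$5) $a\ll c$, $b\ll c$ imply $a+b\ll c$; ($\ll$6) $c\ll a$, $c\ll b$ imply $c\ll a\cdot b$; ($\ll$7) $a\ll b$, $b\cdot c\ll d$, $c\ll a+d$ imply $c\ll d$; (MC1) $aCb$, $a\ll c$ imply $aC(b\cdot c)$; (MC2) $a\overline C(b\cdot c)$, $aCb$, $(a\cdot d)\overline Cb$ imply $d\widehat Cc$; (M$\widehat C$1) $a\widehat Cb$, $c\ll a$ imply $a\widehat C(b+c)$; (M$\widehat C$2) $a\overline{\widehat C}(b+c)$, $a\widehat Cb$, $(a+d)\overline{\widehat C}b$ imply $dCc$; (M$\ll$1) $a\overline{\widehat C}b$, $a\cdot c\ll b$ imply $c\ll b$; (M$\ll$2) $a\overline Cb$, $b\ll a+c$ imply $b\ll c$. Every contact algebra is an EDC-lattice with $a\widehat Cb$ iff $a^*Cb^*$, and $a\ll b$ iff $a\overline Cb^*$. An EDC-lattice is \emph{U-rich} if: (i) $a\not\le b$ implies that some $c$ satisfies $a+c=1$ and $b+c\ne1$; (ii) $a\ll b$ implies that some $c$ satisfies $b+c=1$ and $a\overline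 Cc$; (iii) $a\overline{\widehat C}b$ implies that some $c,d$ satisfy $a+c=1$, $b+d=1$, $c\overline Cd$. Further axioms: (Ext C), \emph{C-extensionality}: for every $a\neq1$ there is $b\ne0$ with $a\overline Cb$; (Con C): $a\ne0$, $b\neq0$, $a+b=1$ imply $aCb$; (Nor 1): $a\overline Cb$ implies that there are $c,d$ with $c+d=1$, $a\overline Cc$, $b\overline Cd$. For a topological space $X$, $RC(X)$ is the contact algebra of all regular closed sets ($a=\mathrm{Cl}\,\mathrm{Int}\,a$) with $a\le b$ iff $a\subseteq b$, $0=\varnothing$, $1=X$, $a+b=a\cup b$, $a\cdot b=\mathrm{Cl}\,\mathrm{Int}(a\cap b)$, $a^*=\mathrm{Cl}(X\setminus a)$, and $aCb$ iff $a\cap b\neq\varnothing$. $X$ is \emph{semiregular} if it has a closed base consisting of regular closed sets; \emph{weakly regular} if it is semiregular and every nonempty open set $U$ contains $\mathrm{Cl}(V)$ for some nonempty open set $V$; \emph{$\kappa$-normal} if any two disjoint regular closed sets are separated by disjoint open sets; \emph{connected} if it is not the union of two disjoint nonempty open sets. An \emph{embedding} of EDC-lattices $h:D\to E$ is an injective map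 preserving $0,1,+,\cdot$ and preserving and reflecting $C,\widehat C,\ll$. It is \emph{dually dense} if for each $x\neq1$ in $E$ there is $a\in D$ with $x\le h(a)\neq1$. It is \emph{C-separable} if for all $x,y\in E$: $x\overline Cy$ implies that there are $a,b\in D$ with $x\le h(a)$, $y\le h(b)$, $h(a)\overline Ch(b)$; $x\overline{\widehat C}y$ implies that there are $a,b\in D$ with $x+h(a)=1$, $y+h(b)=1$, $h(a)\overline Ch(b)$; $x\ll y$ implies that there are $a,b\in D$ with $x\le h(a)$, $y+h(b)=1$, $h(a)\overline Ch(b)$. A \emph{clan} of $D$ is a set $\Gamma\subseteq D$ with $1\in\Gamma$ and $0\notin\Gamma$ that is upward closed, such that $a+b\in\Gamma$ implies $a\in\Gamma$ or $b\in\Gamma$, and $aCb$ for all $a,b\in\Gamma$. A \emph{maximal clan} is a clan that is maximal with respect to inclusion. \textbf{Theorem (Topological representation theorem for C-extensional U-rich EDC-lattices).} Let $D$ be a C-extensional U-rich EDC-lattice. Then there are a compact weakly regular $T_1$ space $X$ and a dually dense C-separable embedding $h$ of $D$ into the contact algebra $RC(X)$. In fact, one can take for $X$ the set of all maximal clans of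 $D$, with the topology that has the sets $\{\Gamma\in X : a\in\Gamma\}$, $a\in D$, as a closed base, and $h(a)=\{\Gamma\in X : a\in\Gamma\}$. Moreover, for this $X$: (i) $D$ satisfies (Con C) if and only if $RC(X)$ satisfies (Con C); in this case $X$ is connected. (ii) $D$ satisfies (Nor 1) if and only if $RC(X)$ satisfies (Nor 1); in this case $X$ is $\kappa$-normal. -/

import Mathlib

universe u v

/-- A distributive contact lattice: a bounded distributive lattice with a contact relation `C`.
A contact algebra is a Boolean algebra with such a relation. -/
class ContactLattice (D : Type u) [DistribLattice D] [BoundedOrder D] where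
  /-- The contact relation `C`. -/
  C : D → D → Prop
  C1 : ∀ {a b : D}, C a b → a ≠ ⊥ ∧ b ≠ ⊥
  C2 : ∀ {a b a' b' : D}, C a b → a ≤ a' → b ≤ b' → C a' b'
  C3 : ∀ {a b c : D}, C a (b ⊔ c) → C a b ∨ C a c
  C4 : ∀ {a b : D}, C a b → C b a
  C5 : ∀ {a b : D}, a ⊓ b ≠ ⊥ → C a b

/-- An extended distributive contact lattice (EDC-lattice): a bounded distributive lattice with
contact `C`, dual contact `K` and non-tangential part-of `L`. -/
class EDCLattice (D : Type u) [DistribLattice D] [BoundedOrder D] extends ContactLattice D where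
  /-- The dual contact relation. -/
  K : D → D → Prop
  /-- The non-tangential part-of relation. -/
  L : D → D → Prop
  K1 : ∀ {a b : D}, K a b → a ≠ ⊤ ∧ b ≠ ⊤
  K2 : ∀ {a b a' b' : D}, K a b → a' ≤ a → b' ≤ b → K a' b'
  K3 : ∀ {a b c : D}, K a (b ⊓ c) → K a b ∨ K a c
  K4 : ∀ {a b : D}, K a b → K b a
  K5 : ∀ {a b : D}, a ⊔ b ≠ ⊤ → K a b
  L1 : L ⊥ ⊥
  L2 : L ⊤ ⊤
  L3 : ∀ {a b : D}, L a b → a ≤ b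
  L4 : ∀ {a b a' b' : D}, a' ≤ a → L a b → b ≤ b' → L a' b'
  L5 : ∀ {a b c : D}, L a c → L b c → L (a ⊔ b) c
  L6 : ∀ {a b c : D}, L c a → L c b → L c (a ⊓ b)
  L7 : ∀ {a b c d : D}, L a b → L (b ⊓ c) d → L c (a ⊔ d) → L c d
  MC1 : ∀ {a b c : D}, C a b → L a c → C a (b ⊓ c)
  MC2 : ∀ {a b c d : D}, ¬ C a (b ⊓ c) → C a b → ¬ C (a ⊓ d) b → K d c
  MK1 : ∀ {a b c : D}, K a b → L c a → K a (b ⊔ c)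
  MK2 : ∀ {a b c d : D}, ¬ K a (b ⊔ c) → K a b → ¬ K (a ⊔ d) b → C d c
  ML1 : ∀ {a b c : D}, ¬ K a b → L (a ⊓ c) b → L c b
  ML2 : ∀ {a b c : D}, ¬ C a b → L b (a ⊔ c) → L b c

namespace ContactLattice

variable (D : Type u) [DistribLattice D] [BoundedOrder D] [ContactLattice D]

/-- (Ext C): C-extensionality. -/
def ExtC : Prop := ∀ a : D, a ≠ ⊤ → ∃ b : D, b ≠ ⊥ ∧ ¬ C a b

/-- (Con C): C-connectedness. -/
def ConC : Prop := ∀ a b : D, a ≠ ⊥ → b ≠ ⊥ → a ⊔ b = ⊤ → C a b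

/-- (Nor 1). -/
def Nor1 : Prop := ∀ a b : D, ¬ C a b → ∃ c d : D, c ⊔ d = ⊤ ∧ ¬ C a c ∧ ¬ C b d

end ContactLattice

namespace EDCLattice

open ContactLattice (C)

/-- U-rich EDC-lattices: extensionality of underlap together with the two U-rich axioms. -/
structure IsURich (D : Type u) [DistribLattice D] [BoundedOrder D] [EDCLattice D] : Prop where
  ext_underlap : ∀ a b : D, ¬ a ≤ b → ∃ c : D, a ⊔ c = ⊤ ∧ b ⊔ c ≠ ⊤
  rich_L : ∀ a b : D, L a b → ∃ c : D, b ⊔ c = ⊤ ∧ ¬ C a c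
  rich_K : ∀ a b : D, ¬ K a b → ∃ c d : D, a ⊔ c = ⊤ ∧ b ⊔ d = ⊤ ∧ ¬ C c d

/-- Every contact algebra is an EDC-lattice, where dual contact of `a`, `b` is contact of `aᶜ`,
`bᶜ`, and `a` is a non-tangential part of `b` iff `a` is not in contact with `bᶜ`. -/
abbrev ofContactAlgebra (B : Type u) [BooleanAlgebra B] [inst : ContactLattice B] :
    EDCLattice B :=
  -- splitting a contact along `x` and its complement
  have split : ∀ {a b : B} (x : B), C a b → C a (b ⊓ x) ∨ C a (b ⊓ xᶜ) := by
    intro a b x h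
    apply ContactLattice.C3
    rwa [← inf_sup_left, sup_compl_eq_top, inf_top_eq]
  have splitL : ∀ {a b : B} (x : B), C a b → C (a ⊓ x) b ∨ C (a ⊓ xᶜ) b := by
    intro a b x h
    rcases split x (ContactLattice.C4 h) with h | h
    · exact Or.inl (ContactLattice.C4 h)
    · exact Or.inr (ContactLattice.C4 h)
  { toContactLattice := inst
    K := fun a b => C aᶜ bᶜ
    L := fun a b => ¬ C a bᶜ
    K1 := by
      intro a b h
      have := ContactLattice.C1 h
      simpa using this
    K2 := by
      intro a b a' b' h ha hb
      exact ContactLattice.C2 h (compl_le_compl ha) (compl_le_compl hb)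
    K3 := by
      intro a b c h
      rw [compl_inf] at h
      exact ContactLattice.C3 h
    K4 := ContactLattice.C4
    K5 := by
      intro a b h
      apply ContactLattice.C5
      rw [← compl_sup]
      exact fun h0 => h (compl_eq_bot.1 h0)
    L1 := fun h => (ContactLattice.C1 h).1 rfl
    L2 := fun h => (ContactLattice.C1 h).2 compl_top
    L3 := by
      intro a b h
      by_contra hab
      refine h (ContactLattice.C5 fun h0 => hab ?_)
      rwa [← sdiff_eq, sdiff_eq_bot_iff] at h0
    L4 := by
      intro a b a' b' ha h hb h'
      exact h (ContactLattice.C2 h' ha (compl_le_compl hb))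
    L5 := by
      intro a b c ha hb h
      rcases ContactLattice.C3 (ContactLattice.C4 h) with h | h
      · exact ha (ContactLattice.C4 h)
      · exact hb (ContactLattice.C4 h)
    L6 := by
      intro a b c ha hb h
      rw [compl_inf] at h
      rcases ContactLattice.C3 h with h | h
      · exact ha h
      · exact hb h
    L7 := by
      intro a b c d h1 h2 h3 h
      rcases splitL b h with h | h
      · exact h2 (ContactLattice.C2 h (le_of_eq (inf_comm _ _)) le_rfl)
      · rcases split a h with h | h
        · exact h1 (ContactLattice.C2 (ContactLattice.C4 h) inf_le_right inf_le_right)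
        · refine h3 (ContactLattice.C2 h inf_le_left ?_)
          rw [compl_sup, inf_comm]
    MC1 := by
      intro a b c h hl
      rcases split c h with h | h
      · exact h
      · exact absurd (ContactLattice.C2 h le_rfl inf_le_right) hl
    MC2 := by
      intro a b c d h1 h2 h3
      rcases split c h2 with h | h
      · exact absurd h h1
      · rcases splitL d h with h | h
        · exact absurd (ContactLattice.C2 h le_rfl inf_le_left) h3
        · exact ContactLattice.C2 h inf_le_right inf_le_right
    MK1 := by
      intro a b c h hl
      rcases split c h with h | h
      · exact absurd (ContactLattice.C2 (ContactLattice.C4 h) inf_le_right le_rfl) hl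
      · exact ContactLattice.C2 h le_rfl (le_of_eq compl_sup.symm)
    MK2 := by
      intro a b c d h1 h2 h3
      rcases split c h2 with h | h
      · rcases splitL d h with h | h
        · exact ContactLattice.C2 h inf_le_right inf_le_right
        · refine absurd (ContactLattice.C2 h ?_ inf_le_left) h3
          rw [compl_sup]
      · refine absurd (ContactLattice.C2 h le_rfl ?_) h1
        rw [compl_sup]
    ML1 := by
      intro a b c h1 h2 h
      rcases splitL a h with h | h
      · exact h2 (ContactLattice.C2 h (le_of_eq (inf_comm _ _)) le_rfl)
      · exact h1 (ContactLattice.C2 h inf_le_right le_rfl)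
    ML2 := by
      intro a b c h1 h2 h
      rcases split a h with h | h
      · exact h1 (ContactLattice.C2 (ContactLattice.C4 h) inf_le_right le_rfl)
      · refine h2 (ContactLattice.C2 h le_rfl ?_)
        rw [compl_sup, inf_comm] }

end EDCLattice

/-- An embedding of EDC-lattices: an injective homomorphism of bounded lattices under which each
of the three relations corresponds to its restriction to the image. -/
structure EDCEmbedding (D : Type u) (E : Type v) [DistribLattice D] [BoundedOrder D] [EDCLattice D]
    [DistribLattice E] [BoundedOrder E] [EDCLattice E] extends BoundedLatticeHom D E where
  injective' : Function.Injective toFun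
  map_C : ∀ a b : D, ContactLattice.C a b ↔ ContactLattice.C (toFun a) (toFun b)
  map_K : ∀ a b : D, EDCLattice.K a b ↔ EDCLattice.K (toFun a) (toFun b)
  map_L : ∀ a b : D, EDCLattice.L a b ↔ EDCLattice.L (toFun a) (toFun b)

namespace EDCEmbedding

variable {D : Type u} {E : Type v} [DistribLattice D] [BoundedOrder D] [EDCLattice D]
  [DistribLattice E] [BoundedOrder E] [EDCLattice E]

instance : CoeFun (EDCEmbedding D E) (fun _ => D → E) := ⟨fun h => h.toFun⟩

/-- The image is a dually dense sublattice. -/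
def IsDuallyDense (h : EDCEmbedding D E) : Prop :=
  ∀ x : E, x ≠ ⊤ → ∃ a : D, x ≤ h a ∧ h a ≠ ⊤

/-- The image is a C-separable EDC-sublattice. -/
structure IsCSeparable (h : EDCEmbedding D E) : Prop where
  sep_C : ∀ x y : E, ¬ ContactLattice.C x y →
    ∃ a b : D, x ≤ h a ∧ y ≤ h b ∧ ¬ ContactLattice.C (h a) (h b)
  sep_K : ∀ x y : E, ¬ EDCLattice.K x y →
    ∃ a b : D, x ⊔ h a = ⊤ ∧ y ⊔ h b = ⊤ ∧ ¬ ContactLattice.C (h a) (h b)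
  sep_L : ∀ x y : E, EDCLattice.L x y →
    ∃ a b : D, x ≤ h a ∧ y ⊔ h b = ⊤ ∧ ¬ ContactLattice.C (h a) (h b)

end EDCEmbedding

/-- A set is regular closed if it is the closure of its interior. -/
def IsRegClosed {X : Type u} [TopologicalSpace X] (a : Set X) : Prop :=
  closure (interior a) = a

/-- `RC(X)`: the regular closed subsets of `X`. -/
@[ext]
structure RegClosed (X : Type u) [TopologicalSpace X] where
  carrier : Set X
  regular' : IsRegClosed carrier

namespace RegClosed

variable {X : Type u} [TopologicalSpace X]

instance : SetLike (RegClosed X) X where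
  coe := RegClosed.carrier
  coe_injective := fun _ _ h => RegClosed.ext h

theorem regular (a : RegClosed X) : closure (interior (a : Set X)) = a := a.regular'

theorem isClosed (a : RegClosed X) : IsClosed (a : Set X) := by
  rw [← a.regular]; exact isClosed_closure

theorem isRegClosed_closure_interior (s : Set X) : IsRegClosed (closure (interior s)) := by
  refine subset_antisymm ?_ ?_
  · exact closure_minimal interior_subset isClosed_closure
  · exact closure_mono (interior_maximal subset_closure isOpen_interior)

/-- `RC(X)` is ordered by inclusion. -/
instance : PartialOrder (RegClosed X) :=
  PartialOrder.lift (fun a : RegClosed X => (a : Set X)) SetLike.coe_injective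

/-- The Boolean algebra `RC(X)`: `0 = ∅`, `1 = X`, `a + b = a ∪ b`, `a · b = Cl (Int (a ∩ b))` and
`a* = Cl (-a)`. -/
instance : BooleanAlgebra (RegClosed X) where
  sup a b := ⟨(a : Set X) ∪ b, by
    refine subset_antisymm ?_ ?_
    · exact closure_minimal interior_subset (a.isClosed.union b.isClosed)
    · refine Set.union_subset ?_ ?_
      · rw [← a.regular]
        exact closure_mono (interior_mono
          (by rw [a.regular]; exact Set.subset_union_left))
      · rw [← b.regular]
        exact closure_mono (interior_mono
          (by rw [b.regular]; exact Set.subset_union_right))⟩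
  inf a b := ⟨closure (interior ((a : Set X) ∩ b)), isRegClosed_closure_interior _⟩
  compl a := ⟨closure (a : Set X)ᶜ, by
    rw [← a.isClosed.isOpen_compl.interior_eq]; exact isRegClosed_closure_interior _⟩
  top := ⟨Set.univ, by simp [IsRegClosed]⟩
  bot := ⟨∅, by simp [IsRegClosed]⟩
  le_sup_left a b := Set.subset_union_left (s := (a : Set X)) (t := b)
  le_sup_right a b := Set.subset_union_right (s := (a : Set X)) (t := b)
  sup_le a b c h1 h2 := Set.union_subset (s := (a : Set X)) (t := b) (r := c) h1 h2
  inf_le_left a b :=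
    closure_minimal (interior_subset.trans Set.inter_subset_left) a.isClosed
  inf_le_right a b :=
    closure_minimal (interior_subset.trans Set.inter_subset_right) b.isClosed
  le_inf a b c h1 h2 := by
    change (a : Set X) ⊆ closure (interior ((b : Set X) ∩ c))
    rw [← a.regular]
    exact closure_mono (interior_mono (Set.subset_inter h1 h2))
  le_top a := Set.subset_univ (a : Set X)
  bot_le a := Set.empty_subset (a : Set X)
  le_sup_inf a b c := by
    change closure (interior (((a : Set X) ∪ b) ∩ ((a : Set X) ∪ c))) ⊆
      (a : Set X) ∪ closure (interior ((b : Set X) ∩ c))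
    rw [← Set.union_inter_distrib_left]
    refine closure_minimal ?_ (a.isClosed.union isClosed_closure)
    intro x hx
    by_cases hxa : x ∈ (a : Set X)
    · exact Or.inl hxa
    · refine Or.inr (subset_closure ?_)
      refine mem_interior.2 ⟨interior ((a : Set X) ∪ ((b : Set X) ∩ c)) ∩ (a : Set X)ᶜ, ?_,
        isOpen_interior.inter a.isClosed.isOpen_compl, hx, hxa⟩
      rintro y ⟨hy, hya⟩
      exact (interior_subset hy).resolve_left hya
  inf_compl_le_bot a := by
    change closure (interior ((a : Set X) ∩ closure (a : Set X)ᶜ)) ⊆ ∅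
    rw [interior_inter, closure_compl, interior_compl, a.regular,
      show interior (a : Set X) ∩ (a : Set X)ᶜ = ∅ from
        Set.eq_empty_of_forall_notMem (fun x hx => hx.2 (interior_subset hx.1)), closure_empty]
  top_le_sup_compl a := by
    change Set.univ ⊆ (a : Set X) ∪ closure (a : Set X)ᶜ
    intro x _
    by_cases hx : x ∈ (a : Set X)
    · exact Or.inl hx
    · exact Or.inr (subset_closure hx)

/-- The contact algebra `RC(X)`: two regular closed sets are in contact iff they meet. -/
instance : ContactLattice (RegClosed X) where
  C a b := ((a : Set X) ∩ b).Nonempty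
  C1 := by
    rintro a b ⟨x, ha, hb⟩
    refine ⟨?_, ?_⟩
    · rintro rfl; exact ha
    · rintro rfl; exact hb
  C2 := by
    rintro a b a' b' ⟨x, ha, hb⟩ h1 h2
    exact ⟨x, h1 ha, h2 hb⟩
  C3 := by
    rintro a b c ⟨x, ha, hb | hc⟩
    · exact Or.inl ⟨x, ha, hb⟩
    · exact Or.inr ⟨x, ha, hc⟩
  C4 := by
    rintro a b ⟨x, ha, hb⟩
    exact ⟨x, hb, ha⟩
  C5 := by
    intro a b h
    by_contra hne
    rw [Set.not_nonempty_iff_eq_empty] at hne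
    refine h (SetLike.coe_injective ?_)
    change closure (interior ((a : Set X) ∩ b)) = ∅
    rw [hne, interior_empty, closure_empty]

/-- The EDC-lattice `RC(X)`; dual contact and non-tangential part-of are the ones of the contact
algebra `RC(X)`. -/
instance : EDCLattice (RegClosed X) := EDCLattice.ofContactAlgebra (RegClosed X)

theorem le_iff (a b : RegClosed X) : a ≤ b ↔ (a : Set X) ⊆ b := Iff.rfl

theorem coe_top : ((⊤ : RegClosed X) : Set X) = Set.univ := rfl

theorem coe_bot : ((⊥ : RegClosed X) : Set X) = ∅ := rfl

theorem coe_sup (a b : RegClosed X) : ((a ⊔ b : RegClosed X) : Set X) = (a : Set X) ∪ b := rfl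

theorem coe_inf (a b : RegClosed X) :
    ((a ⊓ b : RegClosed X) : Set X) = closure (interior ((a : Set X) ∩ b)) := rfl

theorem coe_compl (a : RegClosed X) : ((aᶜ : RegClosed X) : Set X) = closure (a : Set X)ᶜ := rfl

theorem C_iff (a b : RegClosed X) :
    ContactLattice.C a b ↔ ((a : Set X) ∩ b).Nonempty := Iff.rfl

theorem K_iff (a b : RegClosed X) :
    EDCLattice.K a b ↔ (closure (a : Set X)ᶜ ∩ closure (b : Set X)ᶜ).Nonempty := Iff.rfl

theorem L_iff (a b : RegClosed X) :
    EDCLattice.L a b ↔ (a : Set X) ∩ closure (b : Set X)ᶜ = ∅ :=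
  Set.not_nonempty_iff_eq_empty

end RegClosed

/-- Semiregular: the regular closed sets contain a closed base, that is, there is a family of
regular closed sets such that every closed set is an intersection of members of the family. -/
def IsSemiregularSpace (X : Type u) [TopologicalSpace X] : Prop :=
  ∃ B : Set (Set X), (∀ b ∈ B, IsRegClosed b) ∧
    ∀ F : Set X, IsClosed F → ∃ S ⊆ B, F = ⋂₀ S

/-- Weakly regular: semiregular, and every nonempty open set contains the closure of some nonempty
open set. -/
def IsWeaklyRegularSpace (X : Type u) [TopologicalSpace X] : Prop :=
  IsSemiregularSpace X ∧ ∀ U : Set X, IsOpen U → U.Nonempty →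
    ∃ V : Set X, IsOpen V ∧ V.Nonempty ∧ closure V ⊆ U

/-- κ-normal: disjoint regular closed sets are separated by disjoint open sets. -/
def IsKappaNormalSpace (X : Type u) [TopologicalSpace X] : Prop :=
  ∀ a b : Set X, IsRegClosed a → IsRegClosed b → Disjoint a b → SeparatedNhds a b

/-- Clans of a (distributive) contact lattice. -/
structure IsClan {D : Type u} [DistribLattice D] [BoundedOrder D] [ContactLattice D]
    (Γ : Set D) : Prop where
  top_mem : ⊤ ∈ Γ
  bot_notMem : ⊥ ∉ Γ
  mem_of_le : ∀ {a b : D}, a ∈ Γ → a ≤ b → b ∈ Γ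
  prime : ∀ {a b : D}, a ⊔ b ∈ Γ → a ∈ Γ ∨ b ∈ Γ
  contact : ∀ {a b : D}, a ∈ Γ → b ∈ Γ → ContactLattice.C a b

/-- The maximal clans, that is, the clans that are maximal for inclusion. -/
structure MaxClan (D : Type u) [DistribLattice D] [BoundedOrder D] [ContactLattice D] where
  carrier : Set D
  maximal' : Maximal IsClan carrier

namespace MaxClan

variable {D : Type u} [DistribLattice D] [BoundedOrder D] [ContactLattice D]

/-- The set of maximal clans containing `a`. -/
def basic (a : D) : Set (MaxClan D) := {Γ | a ∈ Γ.carrier}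

theorem basic_sup (a b : D) : basic (a ⊔ b) = basic a ∪ basic b := by
  ext Γ
  refine ⟨fun h => Γ.maximal'.prop.prime h, ?_⟩
  rintro (h | h)
  · exact Γ.maximal'.prop.mem_of_le h le_sup_left
  · exact Γ.maximal'.prop.mem_of_le h le_sup_right

theorem basic_bot : basic (⊥ : D) = ∅ :=
  Set.eq_empty_of_forall_notMem fun Γ h => Γ.maximal'.prop.bot_notMem h

/-- The canonical topology on the set of maximal clans: the sets `basic a` are a closed base, so
the closed sets are exactly the intersections of such sets. -/
instance : TopologicalSpace (MaxClan D) :=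
  TopologicalSpace.ofClosed {F | ∃ A : Set D, F = ⋂ a ∈ A, basic a}
    ⟨{⊥}, by simp [basic_bot]⟩
    (by
      intro 𝒜 h𝒜
      refine ⟨{a | ∃ F ∈ 𝒜, F ⊆ basic a}, ?_⟩
      ext Γ
      simp only [Set.mem_sInter, Set.mem_iInter, Set.mem_ofPred_eq]
      refine ⟨fun h a ⟨F, hF, hFa⟩ => hFa (h F hF), fun h F hF => ?_⟩
      obtain ⟨A, hA⟩ := h𝒜 hF
      rw [hA]
      simp only [Set.mem_iInter]
      intro a ha
      refine h a ⟨F, hF, ?_⟩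
      rw [hA]
      exact Set.biInter_subset_of_mem ha)
    (by
      rintro _ ⟨A, rfl⟩ _ ⟨B, rfl⟩
      refine ⟨{c | ∃ a ∈ A, ∃ b ∈ B, c = a ⊔ b}, ?_⟩
      ext Γ
      simp only [Set.mem_union, Set.mem_iInter, Set.mem_ofPred_eq]
      constructor
      · rintro (h | h) _ ⟨a, ha, b, hb, rfl⟩
        · rw [basic_sup]; exact Or.inl (h a ha)
        · rw [basic_sup]; exact Or.inr (h b hb)
      · intro h
        by_contra hn
        push Not at hn
        obtain ⟨⟨a, ha, hna⟩, ⟨b, hb, hnb⟩⟩ := hn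
        have := h _ ⟨a, ha, b, hb, rfl⟩
        rw [basic_sup] at this
        exact this.elim hna hnb)

theorem isClosed_iff (F : Set (MaxClan D)) :
    IsClosed F ↔ ∃ A : Set D, F = ⋂ a ∈ A, basic a := by
  rw [← isOpen_compl_iff]
  change Fᶜᶜ ∈ {F | ∃ A : Set D, F = ⋂ a ∈ A, basic a} ↔ _
  rw [compl_compl]
  rfl

end MaxClan

/-! Contact is visible on clans: two elements are in contact exactly when some maximal clan contains
both (`contact_iff`). This already makes the clan space compact and T1, since an ultrafilter on the
space yields a clan and any maximal clan above it is a limit.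

U-richness (i) and C-extensionality make the order visible too: if `a ≰ b`, they provide `c` with `a
⊔ c = ⊤` and a nonzero `d` not in contact with `b ⊔ c`, and a maximal clan through `d` must contain
`a` but not `b` (`basic_subset_iff`). So the complement of `basic c` lies in `basic a` iff `a ⊔ c =
⊤`, which makes the basic sets regular closed and the canonical map a lattice embedding.

Compactness shrinks the rest to `D`: regular closed sets out of contact are contained in basic sets
given by elements out of contact (`exists_basicHom_sep`). Since U-richness (ii), (iii) and their
converses, valid in every EDC-lattice, express `L` and `K` through joins equal to `⊤` and
non-contact, both relations are preserved and reflected. C-separability, (Con C) and (Nor 1)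
transfer by the same separation. -/

open ContactLattice (C ExtC ConC Nor1)

/-! ### Clans from prime filters; the compact T1 space of maximal clans. -/

section Clans

variable {D : Type u} [DistribLattice D] [BoundedOrder D] [ContactLattice D]

/-- The ideal of the elements that are not in contact with some member of the filter `U`. -/
def contactIdeal (U : Order.PFilter D) : Order.Ideal D :=
  Order.IsIdeal.toIdeal (I := {y : D | ∃ u ∈ U, ¬ C u y})
    { IsLowerSet := by
        rintro y z hzy ⟨u, hu, h⟩
        exact ⟨u, hu, fun h' => h (ContactLattice.C2 h' le_rfl hzy)⟩
      Nonempty := ⟨⊥, ⊤, U.top_mem, fun h => (ContactLattice.C1 h).2 rfl⟩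
      Directed := by
        rintro y ⟨u, hu, h⟩ z ⟨v, hv, h'⟩
        refine ⟨y ⊔ z, ⟨u ⊓ v, U.inf_mem hu hv, fun hc => ?_⟩, le_sup_left, le_sup_right⟩
        rcases ContactLattice.C3 hc with hc | hc
        · exact h (ContactLattice.C2 hc inf_le_left le_rfl)
        · exact h' (ContactLattice.C2 hc inf_le_right le_rfl) }

theorem mem_contactIdeal {U : Order.PFilter D} {y : D} :
    y ∈ contactIdeal U ↔ ∃ u ∈ U, ¬ C u y := Iff.rfl

/-- If `b` is in contact with every member of the filter `U`, it belongs to a prime filter all of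
whose members are in contact with every member of `U`. -/
theorem exists_prime_ideal_contact (U : Order.PFilter D) {b : D} (hb : ∀ u ∈ U, C u b) :
    ∃ J : Order.Ideal D, J.IsPrime ∧ b ∉ J ∧ ∀ u ∈ U, ∀ v ∉ J, C u v := by
  have hdisj : Disjoint (Order.PFilter.principal b : Set D) (contactIdeal U : Set D) := by
    rw [Set.disjoint_left]
    rintro y hy ⟨u, hu, h⟩
    exact h (ContactLattice.C2 (hb u hu) le_rfl (Order.PFilter.mem_principal.1 hy))
  -- `J` extends the contact ideal, so whatever lies outside `J` is in contact with all of `U`.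
  obtain ⟨J, hJ, hIJ, hd⟩ := DistribLattice.prime_ideal_of_disjoint_filter_ideal hdisj
  refine ⟨J, hJ, fun h => Set.disjoint_left.1 hd (Order.PFilter.mem_principal.2 le_rfl) h, ?_⟩
  intro u hu v hv
  by_contra h
  exact hv (hIJ (mem_contactIdeal.2 ⟨u, hu, h⟩))

theorem contact_of_notMem_ideal {J : Order.Ideal D} (hJ : J.IsPrime) {a b : D} (ha : a ∉ J)
    (hb : b ∉ J) : C a b := by
  refine ContactLattice.C5 fun h => ?_
  exact (hJ.mem_or_mem (h ▸ J.bot_mem)).elim ha hb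

/-- The clan is a union of two prime filters, each meeting the contact condition against the other.
The first is built around `b` against the filter of `a`; the second around `a` against the whole
first prime filter. -/
theorem exists_isClan_of_contact {a b : D} (h : C a b) : ∃ Γ : Set D, IsClan Γ ∧ a ∈ Γ ∧ b ∈ Γ := by
  obtain ⟨I, hI, hbI, hIa⟩ := exists_prime_ideal_contact (Order.PFilter.principal a) (b := b)
    fun u hu => ContactLattice.C2 h (Order.PFilter.mem_principal.1 hu) le_rfl
  have hmem : ∀ u, u ∈ hI.compl_filter.toPFilter ↔ u ∉ I := fun u => Iff.rfl
  obtain ⟨J, hJ, haJ, hJI⟩ := exists_prime_ideal_contact hI.compl_filter.toPFilter (b := a)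
    fun u hu => ContactLattice.C4 (hIa a (Order.PFilter.mem_principal.2 le_rfl) u ((hmem u).1 hu))
  refine ⟨{x | x ∉ I ∨ x ∉ J}, ⟨?_, ?_, ?_, ?_, ?_⟩, Or.inr haJ, Or.inl hbI⟩
  · exact Or.inl fun h => hbI (I.lower le_top h)
  · exact fun h => h.elim (fun h => h I.bot_mem) (fun h => h J.bot_mem)
  · rintro x y hx hxy
    exact hx.imp (fun h h' => h (I.lower hxy h')) (fun h h' => h (J.lower hxy h'))
  · intro x y hxy
    by_contra hn
    simp only [Set.mem_ofPred_eq, not_or, not_not] at hn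
    exact hxy.elim (fun h => h (I.sup_mem hn.1.1 hn.2.1)) (fun h => h (J.sup_mem hn.1.2 hn.2.2))
  · rintro x y (hx | hx) (hy | hy)
    · exact contact_of_notMem_ideal hI hx hy
    · exact hJI x ((hmem x).2 hx) y hy
    · exact ContactLattice.C4 (hJI y ((hmem y).2 hy) x hx)
    · exact contact_of_notMem_ideal hJ hx hy

theorem IsClan.exists_maxClan {Γ : Set D} (hΓ : IsClan Γ) :
    ∃ Δ : MaxClan D, Γ ⊆ Δ.carrier := by
  obtain ⟨Δ, hΓΔ, hΔ⟩ := zorn_subset_nonempty {Γ : Set D | IsClan Γ} (by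
    rintro c hc hchain ⟨Γ₀, hΓ₀⟩
    refine ⟨⋃₀ c, ⟨?_, ?_, ?_, ?_, ?_⟩, fun s hs => Set.subset_sUnion_of_mem hs⟩
    · exact ⟨Γ₀, hΓ₀, (hc hΓ₀).top_mem⟩
    · rintro ⟨s, hs, h⟩
      exact (hc hs).bot_notMem h
    · rintro a b ⟨s, hs, h⟩ hab
      exact ⟨s, hs, (hc hs).mem_of_le h hab⟩
    · rintro a b ⟨s, hs, h⟩
      exact ((hc hs).prime h).imp (fun h => ⟨s, hs, h⟩) (fun h => ⟨s, hs, h⟩)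
    · rintro a b ⟨s, hs, ha⟩ ⟨t, ht, hb⟩
      rcases hchain.total hs ht with hst | hst
      · exact (hc ht).contact (hst ha) hb
      · exact (hc hs).contact ha (hst hb)) Γ hΓ
  exact ⟨⟨Δ, hΔ⟩, hΓΔ⟩

namespace MaxClan

theorem contact_iff {a b : D} : C a b ↔ (basic a ∩ basic b).Nonempty := by
  constructor
  · intro h
    obtain ⟨Γ, hΓ, ha, hb⟩ := exists_isClan_of_contact h
    obtain ⟨Δ, hΔ⟩ := hΓ.exists_maxClan
    exact ⟨Δ, hΔ ha, hΔ hb⟩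
  · rintro ⟨Γ, ha, hb⟩
    exact Γ.maximal'.prop.contact ha hb

theorem basic_top : basic (⊤ : D) = Set.univ :=
  Set.eq_univ_of_forall fun Γ => Γ.maximal'.prop.top_mem

theorem basic_mono {a b : D} (h : a ≤ b) : basic a ⊆ basic b :=
  fun Γ ha => Γ.maximal'.prop.mem_of_le ha h

theorem basic_nonempty {a : D} (h : a ≠ ⊥) : (basic a).Nonempty := by
  obtain ⟨Γ, hΓ, -⟩ := contact_iff.1 (ContactLattice.C5 (a := a) (b := a) (by rwa [inf_idem]))
  exact ⟨Γ, hΓ⟩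

theorem isClosed_basic (a : D) : IsClosed (basic a) :=
  (isClosed_iff _).2 ⟨{a}, by simp⟩

theorem exists_basic_of_notMem {F : Set (MaxClan D)} (hF : IsClosed F) {Γ : MaxClan D}
    (hΓ : Γ ∉ F) : ∃ a : D, F ⊆ basic a ∧ Γ ∉ basic a := by
  obtain ⟨A, rfl⟩ := (isClosed_iff F).1 hF
  simp only [Set.mem_iInter, not_forall] at hΓ
  obtain ⟨a, ha, h⟩ := hΓ
  exact ⟨a, Set.biInter_subset_of_mem ha, h⟩

/-- The intersection of `basic a` over `a ∈ Γ` consists of the maximal clans that include `Γ`; by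
maximality `Γ` is the only one. -/
instance : T1Space (MaxClan D) where
  t1 Γ := by
    refine (isClosed_iff _).2 ⟨Γ.carrier, ?_⟩
    ext Δ
    simp only [Set.mem_singleton_iff, Set.mem_iInter]
    constructor
    · rintro rfl a ha
      exact ha
    · intro h
      have heq : Γ.carrier = Δ.carrier := Γ.maximal'.eq_of_subset Δ.maximal'.prop h
      cases Γ
      cases Δ
      simp_all

/-- For an ultrafilter `F`, the elements whose basic sets belong to `F` form a clan: primality is
that of `F`, and contact holds because two members of `F` meet. Any maximal clan above it is a limit
of `F`. -/
instance : CompactSpace (MaxClan D) where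
  isCompact_univ := by
    rw [isCompact_iff_ultrafilter_le_nhds]
    intro F _
    have hclan : IsClan {a : D | basic a ∈ F} :=
      { top_mem := by
          change basic ⊤ ∈ F
          rw [basic_top]
          exact Filter.univ_mem
        bot_notMem := by
          change basic ⊥ ∉ F
          rw [basic_bot]
          exact F.empty_notMem
        mem_of_le := fun ha hab => Filter.mem_of_superset ha (basic_mono hab)
        prime := by
          intro a b h
          change basic (a ⊔ b) ∈ F at h
          rwa [basic_sup, Ultrafilter.union_mem_iff] at h
        contact := fun ha hb => contact_iff.2 (F.nonempty_of_mem (Filter.inter_mem ha hb)) }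
    obtain ⟨Δ, hΔ⟩ := hclan.exists_maxClan
    refine ⟨Δ, trivial, fun V hV => ?_⟩
    obtain ⟨U, hUV, hU, hΔU⟩ := mem_nhds_iff.1 hV
    obtain ⟨a, ha, hn⟩ := exists_basic_of_notMem hU.isClosed_compl (not_not.2 hΔU)
    refine Filter.mem_of_superset (x := (basic a)ᶜ) ?_
      ((Set.compl_subset_comm.1 ha).trans hUV)
    exact Ultrafilter.compl_mem_iff_notMem.2 fun h => hn (hΔ h)

end MaxClan

end Clans

/-! ### Order, regular closedness and separation for basic sets. -/

namespace MaxClan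

variable {D : Type u} [DistribLattice D] [BoundedOrder D] [EDCLattice D]

theorem basic_subset_iff (hrich : EDCLattice.IsURich D) (hext : ExtC D) {a b : D} :
    basic a ⊆ basic b ↔ a ≤ b := by
  refine ⟨fun h => ?_, basic_mono⟩
  by_contra hab
  obtain ⟨c, hac, hbc⟩ := hrich.ext_underlap a b hab
  obtain ⟨d, hd, hC⟩ := hext _ hbc
  obtain ⟨Γ, hΓ⟩ := basic_nonempty hd
  -- A clan through `d` cannot contain `b ⊔ c`, yet it contains `a ⊔ c = ⊤`; by primality only `a`
  -- remains.
  have hn : b ⊔ c ∉ Γ.carrier := fun h' => hC (Γ.maximal'.prop.contact h' hΓ)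
  have ha : a ⊔ c ∈ Γ.carrier := hac ▸ Γ.maximal'.prop.top_mem
  rcases Γ.maximal'.prop.prime ha with ha | hc
  · exact hn (Γ.maximal'.prop.mem_of_le (h ha) le_sup_left)
  · exact hn (Γ.maximal'.prop.mem_of_le hc le_sup_right)

theorem basic_eq_univ_iff (hrich : EDCLattice.IsURich D) (hext : ExtC D) {a : D} :
    basic a = Set.univ ↔ a = ⊤ := by
  rw [← top_le_iff, ← basic_subset_iff hrich hext, basic_top, Set.univ_subset_iff]

theorem compl_basic_subset_iff (hrich : EDCLattice.IsURich D) (hext : ExtC D) {a c : D} :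
    (basic c)ᶜ ⊆ basic a ↔ a ⊔ c = ⊤ := by
  rw [Set.compl_subset_iff_union, Set.union_comm, ← basic_sup, basic_eq_univ_iff hrich hext]

/-- If a basic set `basic b` contains the closure of the interior of `basic a`, then `a ≤ b`: a `c`
refuting this would give an open set `(basic c)ᶜ` inside `basic a` but not inside `basic b`. -/
theorem isRegClosed_basic (hrich : EDCLattice.IsURich D) (hext : ExtC D) (a : D) :
    IsRegClosed (basic a) := by
  refine subset_antisymm (closure_minimal interior_subset (isClosed_basic a)) ?_
  intro Γ hΓ
  by_contra hn
  obtain ⟨b, hb, hΓb⟩ := exists_basic_of_notMem isClosed_closure hn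
  refine hΓb (basic_mono ?_ hΓ)
  by_contra hab
  obtain ⟨c, hac, hbc⟩ := hrich.ext_underlap a b hab
  refine hbc ((compl_basic_subset_iff hrich hext).1 ?_)
  exact (interior_maximal ((compl_basic_subset_iff hrich hext).2 hac)
    (isClosed_basic c).isOpen_compl).trans (subset_closure.trans hb)

theorem interior_inter_subset_basic_inf (hrich : EDCLattice.IsURich D) (hext : ExtC D) (a b : D) :
    interior (basic a ∩ basic b) ⊆ basic (a ⊓ b) := by
  intro Γ hΓ
  obtain ⟨c, hc, hΓc⟩ := exists_basic_of_notMem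
    (F := (interior (basic a ∩ basic b))ᶜ) isOpen_interior.isClosed_compl (not_not.2 hΓ)
  have hsub := (Set.compl_subset_comm.1 hc).trans interior_subset
  have ha := (compl_basic_subset_iff hrich hext).1 (hsub.trans Set.inter_subset_left)
  have hb := (compl_basic_subset_iff hrich hext).1 (hsub.trans Set.inter_subset_right)
  refine (compl_basic_subset_iff hrich hext (a := a ⊓ b) (c := c)).2 ?_ hΓc
  -- Distributivity combines `a ⊔ c = ⊤` and `b ⊔ c = ⊤` into `(a ⊓ b) ⊔ c = ⊤`.
  rw [sup_inf_right, ha, hb, inf_top_eq]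

/-- The canonical map into the regular closed sets, as a homomorphism of bounded lattices. -/
def basicHom (hrich : EDCLattice.IsURich D) (hext : ExtC D) :
    BoundedLatticeHom D (RegClosed (MaxClan D)) where
  toFun a := ⟨basic a, isRegClosed_basic hrich hext a⟩
  map_sup' a b := RegClosed.ext (basic_sup a b)
  map_inf' a b := by
    refine le_antisymm (le_inf (basic_mono inf_le_left) (basic_mono inf_le_right)) ?_
    exact closure_minimal (interior_inter_subset_basic_inf hrich hext a b) (isClosed_basic _)
  map_top' := RegClosed.ext basic_top
  map_bot' := RegClosed.ext basic_bot

theorem basicHom_injective (hrich : EDCLattice.IsURich D) (hext : ExtC D) :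
    Function.Injective (basicHom hrich hext) := fun _ _ h =>
  le_antisymm ((basic_subset_iff hrich hext).1 (congrArg RegClosed.carrier h).subset)
    ((basic_subset_iff hrich hext).1 (congrArg RegClosed.carrier h).superset)

theorem sup_basicHom_eq_top_iff (hrich : EDCLattice.IsURich D) (hext : ExtC D) {a b : D} :
    basicHom hrich hext a ⊔ basicHom hrich hext b = ⊤ ↔ a ⊔ b = ⊤ := by
  rw [← map_sup, ← map_top (basicHom hrich hext), (basicHom_injective hrich hext).eq_iff]

theorem contact_basicHom_iff (hrich : EDCLattice.IsURich D) (hext : ExtC D) {a b : D} :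
    C (basicHom hrich hext a) (basicHom hrich hext b) ↔ C a b :=
  contact_iff.symm

/-- The sets `(basic a)ᶜ` with `x` below the image of `a` cover the compact set `y`. The family is
directed because such `a` are closed under meets, so a single one covers. -/
theorem exists_basicHom_disjoint (hrich : EDCLattice.IsURich D) (hext : ExtC D)
    {x y : RegClosed (MaxClan D)} (h : ¬ C x y) :
    ∃ a : D, x ≤ basicHom hrich hext a ∧ ¬ C (basicHom hrich hext a) y := by
  have hxy : ∀ Γ ∈ y, Γ ∉ x := fun Γ hy hx => h ⟨Γ, hx, hy⟩
  obtain ⟨⟨a, ha⟩, hya⟩ := y.isClosed.isCompact.elim_directed_cover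
    (fun a : {a : D // x ≤ basicHom hrich hext a} => (basic a.1)ᶜ)
    (fun a => (isClosed_basic a.1).isOpen_compl)
    (by
      intro Γ hΓ
      obtain ⟨a, ha, hn⟩ := exists_basic_of_notMem x.isClosed (hxy Γ hΓ)
      exact Set.mem_iUnion.2 ⟨⟨a, ha⟩, hn⟩)
    (by
      rintro ⟨a, ha⟩ ⟨b, hb⟩
      refine ⟨⟨a ⊓ b, ?_⟩, Set.compl_subset_compl.2 (basic_mono inf_le_left),
        Set.compl_subset_compl.2 (basic_mono inf_le_right)⟩
      rw [map_inf]
      exact le_inf ha hb)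
    (hι := ⟨⟨⊤, by rw [map_top]; exact le_top⟩⟩)
  exact ⟨a, ha, fun ⟨Γ, hΓa, hΓy⟩ => hya hΓy hΓa⟩

theorem exists_basicHom_sep (hrich : EDCLattice.IsURich D) (hext : ExtC D)
    {x y : RegClosed (MaxClan D)} (h : ¬ C x y) :
    ∃ a b : D, x ≤ basicHom hrich hext a ∧ y ≤ basicHom hrich hext b ∧ ¬ C a b := by
  obtain ⟨a, ha, hay⟩ := exists_basicHom_disjoint hrich hext h
  obtain ⟨b, hb, hba⟩ := exists_basicHom_disjoint hrich hext fun h => hay (ContactLattice.C4 h)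
  exact ⟨a, b, ha, hb, fun h =>
    hba ((contact_basicHom_iff hrich hext).2 (ContactLattice.C4 h))⟩

end MaxClan

/-! ### Non-contact as a source of `L` and of the failure of `K`: the converses of U-richness (ii)
and (iii). -/

namespace EDCLattice

variable {D : Type u} [DistribLattice D] [BoundedOrder D] [EDCLattice D]

/-- By `ML2`, the summand `c`, not in contact with `a`, can be dropped from `L a (c ⊔ b)`, which
holds because the join is `⊤`. -/
theorem L_of_not_contact {a b c : D} (hbc : b ⊔ c = ⊤) (h : ¬ C a c) : L a b := by
  refine ML2 (fun h' => h (ContactLattice.C4 h')) (L4 le_top L2 ?_)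
  rw [sup_comm, hbc]

/-- Non-contact of `c` and `d` gives `L c b`, so `MK1` would turn `K b a` into `K b (a ⊔ c)`, that
is `K b ⊤`. -/
theorem not_K_of_not_contact {a b c d : D} (hac : a ⊔ c = ⊤) (hbd : b ⊔ d = ⊤) (h : ¬ C c d) :
    ¬ K a b := fun hK =>
  (K1 (MK1 (K4 hK) (L_of_not_contact hbd h))).2 hac

end EDCLattice

/-! ### The embedding, its density and its separability. -/

namespace MaxClan

variable {D : Type u} [DistribLattice D] [BoundedOrder D] [EDCLattice D]

/-- In `RC(X)` the failure of `K` is non-contact of the complements, to which separation by elements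
of `D` applies; `xᶜ ≤ z` is then read as `x ⊔ z = ⊤`. -/
theorem not_K_regClosed (hrich : EDCLattice.IsURich D) (hext : ExtC D)
    {x y : RegClosed (MaxClan D)} (h : ¬ EDCLattice.K x y) :
    ∃ a b : D, x ⊔ basicHom hrich hext a = ⊤ ∧ y ⊔ basicHom hrich hext b = ⊤ ∧ ¬ C a b := by
  obtain ⟨a, b, ha, hb, hab⟩ := exists_basicHom_sep hrich hext (x := xᶜ) (y := yᶜ) h
  exact ⟨a, b, codisjoint_iff.1 (codisjoint_iff_compl_le_right.2 ha),
    codisjoint_iff.1 (codisjoint_iff_compl_le_right.2 hb), hab⟩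

theorem L_regClosed (hrich : EDCLattice.IsURich D) (hext : ExtC D)
    {x y : RegClosed (MaxClan D)} (h : EDCLattice.L x y) :
    ∃ a b : D, x ≤ basicHom hrich hext a ∧ y ⊔ basicHom hrich hext b = ⊤ ∧ ¬ C a b := by
  obtain ⟨a, b, ha, hb, hab⟩ := exists_basicHom_sep hrich hext (x := x) (y := yᶜ) h
  exact ⟨a, b, ha, codisjoint_iff.1 (codisjoint_iff_compl_le_right.2 hb), hab⟩

/-- The canonical embedding of a C-extensional U-rich EDC-lattice. -/
def embedding (hrich : EDCLattice.IsURich D) (hext : ExtC D) :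
    EDCEmbedding D (RegClosed (MaxClan D)) where
  toBoundedLatticeHom := basicHom hrich hext
  injective' := basicHom_injective hrich hext
  map_C _ _ := contact_iff
  map_K a b := by
    refine not_iff_not.1 ⟨fun h => ?_, fun h => ?_⟩
    · obtain ⟨c, d, hac, hbd, hcd⟩ := hrich.rich_K a b h
      exact EDCLattice.not_K_of_not_contact ((sup_basicHom_eq_top_iff hrich hext).2 hac)
        ((sup_basicHom_eq_top_iff hrich hext).2 hbd)
        (mt (contact_basicHom_iff hrich hext).1 hcd)
    · obtain ⟨c, d, hac, hbd, hcd⟩ := not_K_regClosed hrich hext h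
      exact EDCLattice.not_K_of_not_contact ((sup_basicHom_eq_top_iff hrich hext).1 hac)
        ((sup_basicHom_eq_top_iff hrich hext).1 hbd) hcd
  map_L a b := by
    refine ⟨fun h => ?_, fun h => ?_⟩
    · obtain ⟨c, hbc, hac⟩ := hrich.rich_L a b h
      exact EDCLattice.L_of_not_contact ((sup_basicHom_eq_top_iff hrich hext).2 hbc)
        (mt (contact_basicHom_iff hrich hext).1 hac)
    · obtain ⟨c, d, hac, hbd, hcd⟩ := L_regClosed hrich hext h
      refine EDCLattice.L_of_not_contact ((sup_basicHom_eq_top_iff hrich hext).1 hbd) ?_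
      exact fun h => hcd (ContactLattice.C2 h ((basic_subset_iff hrich hext).1 hac) le_rfl)

theorem embedding_isDuallyDense (hrich : EDCLattice.IsURich D) (hext : ExtC D) :
    (embedding hrich hext).IsDuallyDense := by
  intro x hx
  have : ∃ Γ, Γ ∉ (x : Set (MaxClan D)) := by
    by_contra! h
    exact hx (SetLike.coe_injective (Set.eq_univ_of_forall h))
  obtain ⟨Γ, hΓ⟩ := this
  obtain ⟨a, ha, hn⟩ := exists_basic_of_notMem x.isClosed hΓ
  refine ⟨a, ha, fun h => hn ?_⟩
  have h' : basic a = Set.univ := congrArg RegClosed.carrier h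
  rw [h']
  trivial

theorem embedding_isCSeparable (hrich : EDCLattice.IsURich D) (hext : ExtC D) :
    (embedding hrich hext).IsCSeparable where
  sep_C _ _ h := by
    obtain ⟨a, b, ha, hb, hab⟩ := exists_basicHom_sep hrich hext h
    exact ⟨a, b, ha, hb, mt (contact_basicHom_iff hrich hext).1 hab⟩
  sep_K _ _ h := by
    obtain ⟨a, b, ha, hb, hab⟩ := not_K_regClosed hrich hext h
    exact ⟨a, b, ha, hb, mt (contact_basicHom_iff hrich hext).1 hab⟩
  sep_L _ _ h := by
    obtain ⟨a, b, ha, hb, hab⟩ := L_regClosed hrich hext h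
    exact ⟨a, b, ha, hb, mt (contact_basicHom_iff hrich hext).1 hab⟩

/-! ### Weak regularity and the transfer of (Con C) and (Nor 1). -/

theorem isWeaklyRegularSpace (hrich : EDCLattice.IsURich D) (hext : ExtC D) :
    IsWeaklyRegularSpace (MaxClan D) := by
  refine ⟨⟨Set.range basic, ?_, fun F hF => ?_⟩, ?_⟩
  · rintro _ ⟨a, rfl⟩
    exact isRegClosed_basic hrich hext a
  · obtain ⟨A, rfl⟩ := (isClosed_iff F).1 hF
    exact ⟨basic '' A, Set.image_subset_range _ _, by rw [Set.sInter_image]⟩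
  · rintro U hU ⟨Γ, hΓ⟩
    obtain ⟨a, ha, hn⟩ := exists_basic_of_notMem hU.isClosed_compl (not_not.2 hΓ)
    have hatop : a ≠ ⊤ := by
      rintro rfl
      exact hn Γ.maximal'.prop.top_mem
    -- As `b` is not in contact with `a`, the set `basic b` misses `basic a ⊇ Uᶜ`; its interior is
    -- the required open set.
    obtain ⟨b, hb, hab⟩ := hext a hatop
    have hreg : closure (interior (basic b)) = basic b := isRegClosed_basic hrich hext b
    refine ⟨interior (basic b), isOpen_interior, ?_, ?_⟩
    · rw [← closure_nonempty_iff, hreg]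
      exact basic_nonempty hb
    · rw [hreg]
      intro Δ hΔ
      by_contra hU
      exact hab (Δ.maximal'.prop.contact (ha hU) hΔ)

theorem conC_iff (hrich : EDCLattice.IsURich D) (hext : ExtC D) :
    ConC D ↔ ConC (RegClosed (MaxClan D)) := by
  constructor
  · intro h x y hx hy hxy
    by_contra hC
    obtain ⟨a, b, ha, hb, hab⟩ := exists_basicHom_sep hrich hext hC
    refine hab (h a b ?_ ?_ ?_)
    · rintro rfl
      exact hx (le_bot_iff.1 (ha.trans_eq (map_bot _)))
    · rintro rfl
      exact hy (le_bot_iff.1 (hb.trans_eq (map_bot _)))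
    · exact (sup_basicHom_eq_top_iff hrich hext).1
        (top_le_iff.1 (hxy.symm.trans_le (sup_le_sup ha hb)))
  · intro h a b ha hb hab
    refine (contact_basicHom_iff hrich hext).1 (h _ _ ?_ ?_
      ((sup_basicHom_eq_top_iff hrich hext).2 hab))
    · exact fun h0 => ha (basicHom_injective hrich hext (h0.trans (map_bot _).symm))
    · exact fun h0 => hb (basicHom_injective hrich hext (h0.trans (map_bot _).symm))

theorem nor1_iff (hrich : EDCLattice.IsURich D) (hext : ExtC D) :
    Nor1 D ↔ Nor1 (RegClosed (MaxClan D)) := by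
  constructor
  · intro h x y hxy
    obtain ⟨a, b, ha, hb, hab⟩ := exists_basicHom_sep hrich hext hxy
    obtain ⟨c, d, hcd, hac, hbd⟩ := h a b hab
    refine ⟨basicHom hrich hext c, basicHom hrich hext d,
      (sup_basicHom_eq_top_iff hrich hext).2 hcd, fun h => hac ?_, fun h => hbd ?_⟩
    · exact (contact_basicHom_iff hrich hext).1 (ContactLattice.C2 h ha le_rfl)
    · exact (contact_basicHom_iff hrich hext).1 (ContactLattice.C2 h hb le_rfl)
  · intro h a b hab
    obtain ⟨x, y, hxy, hax, hby⟩ := h _ _ (mt (contact_basicHom_iff hrich hext).1 hab)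
    -- The witnesses `x`, `y` need not come from `D`; enlarging them to images of `c`, `d` keeps the
    -- join `⊤` and the non-contact with `a`, `b`.
    obtain ⟨c, hc, hca⟩ := exists_basicHom_disjoint hrich hext fun h => hax (ContactLattice.C4 h)
    obtain ⟨d, hd, hdb⟩ := exists_basicHom_disjoint hrich hext fun h => hby (ContactLattice.C4 h)
    refine ⟨c, d, (sup_basicHom_eq_top_iff hrich hext).1
      (top_le_iff.1 (hxy.symm.trans_le (sup_le_sup hc hd))), fun h => hca ?_, fun h => hdb ?_⟩
    · exact (contact_basicHom_iff hrich hext).2 (ContactLattice.C4 h)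
    · exact (contact_basicHom_iff hrich hext).2 (ContactLattice.C4 h)

end MaxClan

/-! ### Topological meaning of (Con C) and (Nor 1) in `RC(X)`. -/

namespace RegClosed

variable {X : Type u} [TopologicalSpace X]

theorem preconnectedSpace_of_conC (h : ConC (RegClosed X)) : PreconnectedSpace X := by
  rw [preconnectedSpace_iff_clopen]
  intro s hs
  by_contra! hne
  have hreg : ∀ t : Set X, IsClopen t → IsRegClosed t := fun t ht => by
    rw [IsRegClosed, ht.isOpen.interior_eq, ht.isClosed.closure_eq]
  -- A clopen set and its complement are regular closed with join `⊤` and no common point, so (Con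
  -- C) forbids both from being nonempty.
  obtain ⟨x, hx, hx'⟩ := h ⟨s, hreg s hs⟩ ⟨sᶜ, hreg _ hs.compl⟩
    (fun h0 => hne.1.ne_empty (congrArg RegClosed.carrier h0))
    (fun h0 => hne.2 (Set.compl_empty_iff.1 (congrArg RegClosed.carrier h0)))
    (RegClosed.ext (Set.union_compl_self s))
  exact hx' hx

theorem isKappaNormalSpace_of_nor1 (h : Nor1 (RegClosed X)) : IsKappaNormalSpace X := by
  intro a b ha hb hab
  obtain ⟨c, d, hcd, hac, hbd⟩ := h ⟨a, ha⟩ ⟨b, hb⟩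
    fun ⟨x, hxa, hxb⟩ => Set.disjoint_left.1 hab hxa hxb
  -- The complements of `c` and `d` are disjoint because `c ⊔ d = ⊤`.
  refine ⟨(c : Set X)ᶜ, (d : Set X)ᶜ, c.isClosed.isOpen_compl, d.isClosed.isOpen_compl,
    fun x hx hc => hac ⟨x, hx, hc⟩, fun x hx hd => hbd ⟨x, hx, hd⟩, ?_⟩
  rw [Set.disjoint_compl_left_iff_subset, Set.compl_subset_iff_union, Set.union_comm]
  exact congrArg RegClosed.carrier hcd

end RegClosed

theorem mainTheorem9 {D : Type u} [DistribLattice D] [BoundedOrder D] [EDCLattice D]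
    (hrich : EDCLattice.IsURich D) (hext : ContactLattice.ExtC D) :
    ∃ h : EDCEmbedding D (RegClosed (MaxClan D)),
      (∀ a : D, (h a : Set (MaxClan D)) = {Γ | a ∈ Γ.carrier}) ∧
      CompactSpace (MaxClan D) ∧
      IsWeaklyRegularSpace (MaxClan D) ∧
      T1Space (MaxClan D) ∧
      h.IsDuallyDense ∧
      h.IsCSeparable ∧
      (ContactLattice.ConC D ↔ ContactLattice.ConC (RegClosed (MaxClan D))) ∧
      (ContactLattice.ConC D → PreconnectedSpace (MaxClan D)) ∧
      (ContactLattice.Nor1 D ↔ ContactLattice.Nor1 (RegClosed (MaxClan D))) ∧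
      (ContactLattice.Nor1 D → IsKappaNormalSpace (MaxClan D)) := by
  exact ⟨MaxClan.embedding hrich hext, fun _ => rfl, inferInstance,
    MaxClan.isWeaklyRegularSpace hrich hext, inferInstance,
    MaxClan.embedding_isDuallyDense hrich hext, MaxClan.embedding_isCSeparable hrich hext,
    MaxClan.conC_iff hrich hext,
    fun h => RegClosed.preconnectedSpace_of_conC ((MaxClan.conC_iff hrich hext).1 h),
    MaxClan.nor1_iff hrich hext,
    fun h => RegClosed.isKappaNormalSpace_of_nor1 ((MaxClan.nor1_iff hrich hext).1 h)⟩
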